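/- Let $q$ be an odd prime power, let $\mathbb F_q\subset\mathbb F_{q^2}$ be the finite fields with $q$ and $q^2$ elements, and let $p$ be their characteristic. Let $f(x)=\sum_{i,j} a_{ij}x^{p^i+p^j}$ be a Dembowski–Ostrom polynomial over $\mathbb F_{q^2}$ such that $f$ is planar on $\mathbb F_{q^2}$, i.e. $x\mapsto f(x+a)-f(x)$ is a bijection for every $a\neq 0$. Let $\Pi(f)$ be the projective plane with points $(x,y)$, $(a)$, $(\infty)$ for $x,y,a\in\mathbb F_{q^2}$, and lines $L_{a,b}=\{(x,f(x+a)-b):x\in\mathbb F_{q^2}\}\cup\{(a)\}$, $N_a=\{(a,y):y\in\mathbb F_{q^2}\}\cup\{(\infty)\}$ for $a,b\in\mathbb F_{q^2}$, and $L_\infty=\{(a):a\in\mathbb F_{q^2}\}\cup\{(\infty)\}$. Let $\kappa:x\mapsto\bar x$ be an additive map on $\mathbb F_{q^2}$ such that (a) $\bar{\bar x}=x$ for all $x$; (b) $\overline{f(x)}=f(\bar x)$ for all $x$; (c) $\#\{y\in\mathbb F_{q^2}:y+\bar y=f(x+\bar x)\}=q$ for every $x\in\mathbb F_{q^2}$.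 Let $\mathcal U=\{(x,y):y+\bar y=f(x+\bar x)\}\cup\{(\infty)\}$ be the unital derived from $\kappa$, i.e. the set of absolute points of the unitary polarity of $\Pi(f)$ given on points by $(x,y)\mapsto L_{\bar x,\bar y}$, $(a)\mapsto N_{\bar a}$, $(\infty)\mapsto L_\infty$. Let $\xi\in\mathbb F_{q^2}\setminus\mathbb F_q$, and write $f(x)=f_0(x)+f_1(x)\xi$ with $f_0,f_1:\mathbb F_{q^2}\to\mathbb F_q$. Let $\theta=\theta_0+\theta_1\xi\neq 0$ with $\theta_0,\theta_1\in\mathbb F_q$ be such that the number of $x\in\mathbb F_{q^2}$ with $\theta_1f_0(x)-\theta_0f_1(x)=c$ is $q+1$ for every $c\in\mathbb F_q\setminus\{0\}$, and is $1$ for $c=0$. Let $\mathcal U_\theta=\{(x,t\theta):x\in\mathbb F_{q^2},\,t\in\mathbb F_q\}\cup\{(\infty)\}$ be the corresponding unital. Then $\mathcal U$ and $\mathcal U_\theta$ are not equivalent: no collineation of $\Pi(f)$ maps $\mathcal U$ onto $\mathcal U_\theta$. -/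

import Mathlib

namespace ShiftPlane

/-- A function `f` on a field is planar if `x ↦ f (x + a) - f x` is a bijection for all `a ≠ 0`. -/
def IsPlanar {F : Type*} [Field F] (f : F → F) : Prop :=
  ∀ a : F, a ≠ 0 → Function.Bijective fun x : F => f (x + a) - f x

/-- A Dembowski–Ostrom polynomial `∑ a_{ij} X^(p^i + p^j)`, with `p` the characteristic:
every exponent that occurs is of the form `p^i + p^j`. -/
def IsDembowskiOstrom {F : Type*} [Field F] (P : Polynomial F) : Prop :=
  ∀ k ∈ P.support, ∃ i j : ℕ, k = ringChar F ^ i + ringChar F ^ j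

/-- The points of `Π(f)`: the affine points `(x, y)`, the points `(a)` and the point `(∞)`. -/
inductive Point (F : Type*) where
  | affine (x y : F) : Point F
  | slope (a : F) : Point F
  | infty : Point F

/-- The (names of the) lines of `Π(f)`: `L_{a,b}`, `N_a` and `L_∞`. -/
inductive Line (F : Type*) where
  | L (a b : F) : Line F
  | N (a : F) : Line F
  | Linf : Line F

/-- The set of points of a line of `Π(f)`. -/
def Line.points {F : Type*} [Field F] (f : F → F) : Line F → Set (Point F)
  | .L a b => {P | ∃ x : F, P = .affine x (f (x + a) - b)} ∪ {.slope a}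
  | .N a => {P | ∃ y : F, P = .affine a y} ∪ {.infty}
  | .Linf => {P | ∃ a : F, P = .slope a} ∪ {.infty}

/-- A collineation of `Π(f)`: a bijection on points together with a bijection on lines that
preserve incidence in both directions. -/
structure Collineation {F : Type*} [Field F] (f : F → F) where
  /-- the action on points -/
  onPoints : Point F ≃ Point F
  /-- the action on lines -/
  onLines : Line F ≃ Line F
  mem_iff : ∀ (P : Point F) (l : Line F),
    onPoints P ∈ (onLines l).points f ↔ P ∈ l.points f

/-- Two point sets of `Π(f)` are equivalent if a collineation of `Π(f)` maps one onto the other. -/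
def Equivalent {F : Type*} [Field F] (f : F → F) (U V : Set (Point F)) : Prop :=
  ∃ φ : Collineation f, φ.onPoints '' U = V

/-- The action on points of the polarity `ρ` induced by `κ`:
`(x, y) ↦ L_{κ x, κ y}`, `(a) ↦ N_{κ a}`, `(∞) ↦ L_∞`. -/
def polarity {F : Type*} (κ : F → F) : Point F → Line F
  | .affine x y => .L (κ x) (κ y)
  | .slope a => .N (κ a)
  | .infty => .Linf

/-- The set of absolute points of the polarity induced by `κ`: the points `P` on `ρ(P)`. -/
def polarityUnital {F : Type*} [Field F] (f κ : F → F) : Set (Point F) :=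
  {P | P ∈ (polarity κ P).points f}

/-- The set `U_θ = {(x, t θ) : x ∈ F, t ∈ K} ∪ {(∞)}`. -/
def thetaUnital (K : Type*) {F : Type*} [Field K] [Field F] [Algebra K F] (θ : F) :
    Set (Point F) :=
  {P | ∃ (x : F) (t : K), P = .affine x (algebraMap K F t * θ)} ∪ {.infty}

end ShiftPlane

/-!
Write `x ∗ a = f (x + a) - f x - f a` for the polarisation of `f` (the map `m` in the lemmas).
Since `f` is a planar Dembowski–Ostrom polynomial, `∗` is a commutative biadditive product without
zero divisors, and
the maps `(x, y) ↦ (x + u, y + v + x ∗ w)` extend to collineations of the plane (`elation`).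

The elations preserving the polarity unital `U` (written `U_κ` in the docstrings) act transitively
on its affine points, and so do
those preserving `U_θ`. Hence, if some collineation maps `U` onto `U_θ` without fixing `(∞)`, then
the stabiliser of `U_θ` is transitive, and another collineation maps `U` onto `U_θ` and fixes `(∞)`
(`exists_collineation_fixing_infty`). It then fixes the common tangent `L_∞` of both unitals at
`(∞)`.

A collineation that fixes `(∞)` and `L_∞` is the product of an elation and an autotopism of `∗`,
that is, a triple `α, β, γ` with `γ (x ∗ a) = α x ∗ β a` (`exists_autotopism`). Now `U` is
invariant under `(x, y) ↦ (x + u, y + v + x ∗ (u + κ u))` for suitable `v`, while an elation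
preserves `U_θ` only if `w = 0`. Transporting the former along the autotopism gives
`β (κ u) = -α u`, so `γ (x ∗ κ u) = -(α x ∗ α u)` is symmetric in `x` and `u`. This fails when
`x` is fixed and `u` is negated by `κ`, and (c) provides nonzero elements of both kinds. In group
terms: the group of elations stabilising `U` is a nonabelian group of order `q ^ 3`, the one
stabilising `U_θ` is an abelian one.
-/

namespace ShiftPlane

/-! ### Incidence and the group of collineations -/

section Incidence

variable {F : Type*} [Field F] {f : F → F}

@[simp] lemma affine_mem_L {x y a b : F} :
    Point.affine x y ∈ (Line.L a b).points f ↔ y = f (x + a) - b := by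
  simp [Line.points]

@[simp] lemma slope_mem_L {a b c : F} :
    Point.slope c ∈ (Line.L a b).points f ↔ c = a := by
  simp [Line.points]

@[simp] lemma infty_notMem_L {a b : F} : Point.infty ∉ (Line.L a b).points f := by
  simp [Line.points]

@[simp] lemma affine_mem_N {x y a : F} :
    Point.affine x y ∈ (Line.N a).points f ↔ x = a := by
  simp [Line.points]

@[simp] lemma slope_notMem_N {a c : F} : Point.slope c ∉ (Line.N a).points f := by
  simp [Line.points]

@[simp] lemma infty_mem_N {a : F} : Point.infty ∈ (Line.N a).points f := by
  simp [Line.points]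

@[simp] lemma affine_notMem_Linf {x y : F} :
    Point.affine x y ∉ (Line.Linf).points f := by
  simp [Line.points]

@[simp] lemma slope_mem_Linf {c : F} : Point.slope c ∈ (Line.Linf).points f := by
  simp [Line.points]

@[simp] lemma infty_mem_Linf : Point.infty ∈ (Line.Linf : Line F).points f := by
  simp [Line.points]

/-- The composition of two collineations, the first argument being applied first. -/
def Collineation.trans (φ ψ : Collineation f) : Collineation f where
  onPoints := φ.onPoints.trans ψ.onPoints
  onLines := φ.onLines.trans ψ.onLines
  mem_iff P l := by simp [ψ.mem_iff, φ.mem_iff]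

/-- The inverse of a collineation. -/
def Collineation.symm (φ : Collineation f) : Collineation f where
  onPoints := φ.onPoints.symm
  onLines := φ.onLines.symm
  mem_iff P l := by
    simpa using (φ.mem_iff (φ.onPoints.symm P) (φ.onLines.symm l)).symm

end Incidence

/-! ### The product attached to a planar Dembowski–Ostrom polynomial -/

section Product

variable {F : Type*} [Field F] {f : F → F}

/-- The exponents `p ^ i + p ^ j` make the polarisation of `f` biadditive. -/
lemma IsDembowskiOstrom.exists_polarization [Finite F] {P : Polynomial F}
    (hP : IsDembowskiOstrom P) (hfP : ∀ x, f x = P.eval x) :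
    ∃ m : F →+ F →+ F, ∀ x y, f (x + y) = f x + f y + m x y := by
  have hp : Fact (ringChar F).Prime := ⟨CharP.char_is_prime F _⟩
  have hleft (x y z : F) : f (x + y + z) - f (x + y) - f z =
      (f (x + z) - f x - f z) + (f (y + z) - f y - f z) := by
    simp only [hfP, Polynomial.eval_eq_sum, Polynomial.sum, ← Finset.sum_sub_distrib,
      ← Finset.sum_add_distrib]
    refine Finset.sum_congr rfl fun k hk => ?_
    obtain ⟨i, j, rfl⟩ := hP k hk
    simp only [pow_add, add_pow_char_pow]
    ring
  refine ⟨AddMonoidHom.mk' (fun x => AddMonoidHom.mk' (fun y => f (x + y) - f x - f y) ?_) ?_, ?_⟩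
  · intro y z
    have h := hleft y z x
    rw [add_comm (y + z) x, add_comm y x, add_comm z x] at h
    linear_combination h
  · intro x y
    ext z
    exact hleft x y z
  · intro x y
    simp

variable {m : F →+ F →+ F}

lemma polarization_comm (hm : ∀ x y, f (x + y) = f x + f y + m x y) (x y : F) :
    m x y = m y x := by
  have h := hm x y
  rw [add_comm x y, hm y x] at h
  linear_combination -h

lemma map_zero_of_polarization (hm : ∀ x y, f (x + y) = f x + f y + m x y) : f 0 = 0 := by
  simpa using hm 0 0

lemma IsPlanar.polarization_bijective (hf : IsPlanar f)
    (hm : ∀ x y, f (x + y) = f x + f y + m x y) {a : F} (ha : a ≠ 0) :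
    Function.Bijective fun x => m x a := by
  have h : (fun x => m x a) = Equiv.subRight (f a) ∘ fun x => f (x + a) - f x := by
    funext x
    simp only [Function.comp_apply, Equiv.subRight_apply, hm x a]
    ring
  rw [h]
  exact (Equiv.bijective _).comp (hf a ha)

end Product

/-! ### Elations -/

section Elation

variable {F : Type*} [Field F] {f : F → F} {m : F →+ F →+ F}

/-- The collineation `(x, y) ↦ (x + u, y + v + x ∗ w)`. In the coordinates `(x, y - f x)`, in which
the lines `L_{a,b}` have equations `y = x ∗ a + c`, it is the product of a translation and an
elation with center `(∞)`. -/
def elation (m : F →+ F →+ F) (hm : ∀ x y, f (x + y) = f x + f y + m x y) (u v w : F) :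
    Collineation f where
  onPoints :=
    { toFun
        | .affine x y => .affine (x + u) (y + v + m x w)
        | .slope a => .slope (a - u + w)
        | .infty => .infty
      invFun
        | .affine x y => .affine (x - u) (y - v - m (x - u) w)
        | .slope a => .slope (a + u - w)
        | .infty => .infty
      left_inv := by rintro (⟨x, y⟩ | a | _) <;> simp <;> ring
      right_inv := by rintro (⟨x, y⟩ | a | _) <;> simp <;> ring }
  onLines :=
    { toFun
        | .L a b => .L (a - u + w) (b - v + f w + m a w)
        | .N a => .N (a + u)
        | .Linf => .Linf
      invFun
        | .L a b => .L (a + u - w) (b + v - f w - m (a + u - w) w)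
        | .N a => .N (a - u)
        | .Linf => .Linf
      left_inv := by
        rintro (⟨a, b⟩ | a | _) <;> simp
        exact ⟨by ring, by ring⟩
      right_inv := by
        rintro (⟨a, b⟩ | a | _) <;> simp only [sub_add_cancel, Line.L.injEq]
        exact ⟨by ring, by ring⟩ }
  mem_iff := by
    rintro (⟨x, y⟩ | c | _) (⟨a, b⟩ | a | _) <;> simp
    have h : f (x + u + (a - u + w)) = f (x + a) + f w + (m x w + m a w) := by
      rw [show x + u + (a - u + w) = x + a + w by ring, hm (x + a) w, map_add,
        AddMonoidHom.add_apply]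
    rw [h]
    constructor <;> intro h <;> linear_combination h

variable (hm : ∀ x y, f (x + y) = f x + f y + m x y) (u v w : F)

@[simp] lemma elation_affine (x y : F) :
    (elation m hm u v w).onPoints (.affine x y) = .affine (x + u) (y + v + m x w) := rfl

@[simp] lemma elation_slope (a : F) :
    (elation m hm u v w).onPoints (.slope a) = .slope (a - u + w) := rfl

@[simp] lemma elation_infty : (elation m hm u v w).onPoints .infty = .infty := rfl

@[simp] lemma elation_Linf : (elation m hm u v w).onLines .Linf = .Linf := rfl

end Elation

/-! ### Collineations fixing `(∞)` and `L_∞` -/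

section Autotopism

variable {F : Type*} [Field F] {f : F → F} {m : F →+ F →+ F}

/-- A collineation that fixes the triangle `(∞)`, `(0)`, `(0, 0)` and the line `L_∞` is an
autotopism of the product `m`, in the coordinates `(x, y - f x)`. -/
lemma exists_autotopism_of_fixes_triangle (hm : ∀ x y, f (x + y) = f x + f y + m x y)
    (hreg : ∀ a ≠ 0, Function.Bijective fun x => m x a) (φ : Collineation f)
    (h_infty : φ.onPoints .infty = .infty) (h_Linf : φ.onLines .Linf = .Linf)
    (h_origin : φ.onPoints (.affine 0 0) = .affine 0 0)
    (h_slope : φ.onPoints (.slope 0) = .slope 0) :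
    ∃ (α γ : F →+ F) (β : F → F), Function.Injective α ∧ Function.Injective β ∧ β 0 = 0 ∧
      (∀ x a, γ (m x a) = m (α x) (β a)) ∧
      ∀ x y, φ.onPoints (.affine x (y + f x)) = .affine (α x) (γ y + f (α x)) := by
  have hf0 := map_zero_of_polarization hm
  have hslope : ∀ a, ∃ b, φ.onPoints (.slope a) = .slope b := by
    intro a
    have h1 := (φ.mem_iff (.slope a) .Linf).2 (by simp)
    have h2 : φ.onPoints (.slope a) ≠ φ.onPoints .infty := by simp
    rw [h_Linf] at h1
    rw [h_infty] at h2
    rcases h : φ.onPoints (.slope a) with ⟨x, y⟩ | b | _ <;> simp_all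
  choose β hβ using hslope
  have hN : ∀ a, ∃ b, φ.onLines (.N a) = .N b := by
    intro a
    have h1 := (φ.mem_iff .infty (.N a)).2 (by simp)
    have h2 : φ.onLines (.N a) ≠ φ.onLines .Linf := by simp
    rw [h_infty] at h1
    rw [h_Linf] at h2
    rcases h : φ.onLines (.N a) with ⟨x, y⟩ | b | _ <;> simp_all
  choose α hα using hN
  have haff : ∀ x y, ∃ z, φ.onPoints (.affine x y) = .affine (α x) z := by
    intro x y
    have h1 := (φ.mem_iff (.affine x y) (.N x)).2 (by simp)
    have h2 : φ.onPoints (.affine x y) ≠ φ.onPoints .infty := by simp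
    rw [hα] at h1
    rw [h_infty] at h2
    rcases h : φ.onPoints (.affine x y) with ⟨x, y⟩ | b | _ <;> simp_all
  choose δ hδ using haff
  have hL : ∀ a b, ∃ c, φ.onLines (.L a b) = .L (β a) c := by
    intro a b
    have h1 := (φ.mem_iff (.slope a) (.L a b)).2 (by simp)
    have h2 : φ.onLines (.L a b) ≠ φ.onLines .Linf := by simp
    rw [hβ] at h1
    rw [h_Linf] at h2
    rcases h : φ.onLines (.L a b) with ⟨x, y⟩ | b | _ <;> simp_all
  choose ε hε using hL
  have hα0 : α 0 = 0 := by simpa [hδ] using congrArg (fun P => P ∈ (Line.N 0).points f) h_origin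
  have hδ0 : δ 0 0 = 0 := by
    rw [hδ] at h_origin
    exact (Point.affine.inj h_origin).2
  have hβ0 : β 0 = 0 := by
    rw [hβ] at h_slope
    exact Point.slope.inj h_slope
  have hαinj : Function.Injective α := fun x y h => by
    have : φ.onLines (.N x) = φ.onLines (.N y) := by rw [hα, hα, h]
    simpa using this
  have hβinj : Function.Injective β := fun x y h => by
    have : φ.onPoints (.slope x) = φ.onPoints (.slope y) := by rw [hβ, hβ, h]
    simpa using this
  -- the point `(x, f (x + a) - b)` lies on the line `L_{a,b}`
  have key : ∀ x a b, δ x (f (x + a) - b) = f (α x + β a) - ε a b := by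
    intro x a b
    have h := (φ.mem_iff (.affine x (f (x + a) - b)) (.L a b)).2 (by simp)
    simpa [hδ, hε] using h
  -- horizontal lines go to horizontal lines, so the second coordinate is transformed by itself
  obtain ⟨γ, hγ⟩ : ∃ γ : F → F, ∀ x y, δ x (y + f x) = γ y + f (α x) := by
    refine ⟨fun y => -ε 0 (-y), fun x y => ?_⟩
    have h := key x 0 (-y)
    rw [hβ0, add_zero, add_zero] at h
    rw [show y + f x = f x - -y by ring, h]
    ring
  have hγm' : ∀ x a c, γ (m x a + c) = m (α x) (β a) + (f (β a) - ε a (f a - c)) := by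
    intro x a c
    have h := key x a (f a - c)
    rw [show f (x + a) - (f a - c) = m x a + c + f x by rw [hm]; ring, hγ, hm] at h
    linear_combination h
  have hγm : ∀ x a c, γ (m x a + c) = m (α x) (β a) + γ c := by
    intro x a c
    have h := hγm' 0 a c
    rw [hα0, map_zero, AddMonoidHom.zero_apply, AddMonoidHom.zero_apply, zero_add, zero_add] at h
    rw [hγm', h]
  have hγ0 : γ 0 = 0 := by
    have h := hγ 0 0
    rw [hf0, hα0, hf0, add_zero, hδ0, add_zero] at h
    exact h.symm
  have hγm0 : ∀ x a, γ (m x a) = m (α x) (β a) := by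
    intro x a
    simpa [hγ0] using hγm x a 0
  have hγadd : ∀ y z, γ (y + z) = γ y + γ z := by
    intro y z
    obtain ⟨x, rfl⟩ := (hreg 1 one_ne_zero).2 y
    simp only [hγm, hγm0]
  have hβ1 : β 1 ≠ 0 := fun h => one_ne_zero (hβinj (h.trans hβ0.symm))
  have hαadd : ∀ x y, α (x + y) = α x + α y := by
    intro x y
    apply (hreg _ hβ1).1
    simp only [map_add, AddMonoidHom.add_apply, ← hγm0, ← hγadd]
  refine ⟨AddMonoidHom.mk' α hαadd, AddMonoidHom.mk' γ hγadd, β, hαinj, hβinj, hβ0, hγm0, ?_⟩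
  intro x y
  rw [hδ, hγ]
  rfl

/-- A collineation that fixes `(∞)` and `L_∞` is an autotopism of `m` composed with an elation. -/
lemma exists_autotopism (hm : ∀ x y, f (x + y) = f x + f y + m x y)
    (hreg : ∀ a ≠ 0, Function.Bijective fun x => m x a) (φ : Collineation f)
    (h_infty : φ.onPoints .infty = .infty) (h_Linf : φ.onLines .Linf = .Linf) :
    ∃ (α γ : F →+ F) (β : F → F) (u v w : F),
      Function.Injective α ∧ Function.Injective β ∧ β 0 = 0 ∧
      (∀ x a, γ (m x a) = m (α x) (β a)) ∧
      ∀ x y, φ.onPoints (.affine x (y + f x)) =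
        .affine (α x + u) (γ y + f (α x) + v + m (α x) w) := by
  obtain ⟨x₀, y₀, h₀⟩ : ∃ x y, φ.onPoints (.affine 0 0) = .affine x y := by
    have h1 := (φ.mem_iff (.affine 0 0) .Linf).not.2 (by simp)
    rw [h_Linf] at h1
    rcases h : φ.onPoints (.affine 0 0) with ⟨x, y⟩ | b | _ <;> simp_all
  obtain ⟨a₀, ha₀⟩ : ∃ a, φ.onPoints (.slope 0) = .slope a := by
    have h1 := (φ.mem_iff (.slope 0) .Linf).2 (by simp)
    have h2 : φ.onPoints (.slope 0) ≠ φ.onPoints .infty := by simp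
    rw [h_Linf] at h1
    rw [h_infty] at h2
    rcases h : φ.onPoints (.slope 0) with ⟨x, y⟩ | b | _ <;> simp_all
  -- the elation `g` takes `(0, 0)` and `(0)` to their images under `φ`
  let g := elation m hm x₀ y₀ (a₀ + x₀)
  have hg1 : g.onPoints (.affine 0 0) = .affine x₀ y₀ := by simp [g]
  have hg2 : g.onPoints (.slope 0) = .slope a₀ := by simp [g]
  have hg3 : g.onPoints .infty = .infty := rfl
  have hg4 : g.onLines .Linf = .Linf := rfl
  obtain ⟨α, γ, β, hα, hβ, hβ0, hγ, h⟩ := exists_autotopism_of_fixes_triangle hm hreg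
    (φ.trans g.symm)
    (by simp [Collineation.trans, Collineation.symm, Equiv.symm_apply_eq, h_infty, hg3])
    (by simp [Collineation.trans, Collineation.symm, Equiv.symm_apply_eq, h_Linf, hg4])
    (by simp [Collineation.trans, Collineation.symm, Equiv.symm_apply_eq, h₀, hg1])
    (by simp [Collineation.trans, Collineation.symm, Equiv.symm_apply_eq, ha₀, hg2])
  refine ⟨α, γ, β, x₀, y₀, a₀ + x₀, hα, hβ, hβ0, hγ, fun x y => ?_⟩
  have h' := h x y
  simp only [Collineation.trans, Collineation.symm, Equiv.trans_apply,
    Equiv.symm_apply_eq] at h'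
  exact h'

end Autotopism

/-! ### The two unitals -/

section Unitals

variable {F : Type*} [Field F] {f : F → F} {m : F →+ F →+ F}

@[simp] lemma affine_mem_polarityUnital {κ : F → F} {x y : F} :
    Point.affine x y ∈ polarityUnital f κ ↔ y + κ y = f (x + κ x) := by
  simp [polarityUnital, polarity, eq_sub_iff_add_eq]

@[simp] lemma slope_notMem_polarityUnital {κ : F → F} {a : F} :
    Point.slope a ∉ polarityUnital f κ := by
  simp [polarityUnital, polarity]

@[simp] lemma infty_mem_polarityUnital {κ : F → F} : Point.infty ∈ polarityUnital f κ := by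
  simp [polarityUnital, polarity]

/-- The elations stabilising `U_κ` are those with `w = u + κ u` and `v + κ v = f (u + κ u)`. -/
lemma elation_mem_polarityUnital_iff (hm : ∀ x y, f (x + y) = f x + f y + m x y) {κ : F →+ F}
    (hκm : ∀ x y, κ (m x y) = m (κ x) (κ y)) (hκ : ∀ x, κ (κ x) = x) {u v : F}
    (huv : v + κ v = f (u + κ u)) (P : Point F) :
    (elation m hm u v (u + κ u)).onPoints P ∈ polarityUnital f κ ↔ P ∈ polarityUnital f κ := by
  rcases P with ⟨x, y⟩ | a | _
  · have h : f (x + u + κ (x + u)) = f (x + κ x) + f (u + κ u) + m (x + κ x) (u + κ u) := by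
      rw [← hm, map_add]
      congr 1
      ring
    have h' : m (x + κ x) (u + κ u) = m x (u + κ u) + κ (m x (u + κ u)) := by
      rw [hκm, map_add κ u, hκ, add_comm (κ u) u, map_add m, AddMonoidHom.add_apply]
    simp only [elation_affine, affine_mem_polarityUnital]
    rw [h, h', ← huv, map_add κ, map_add κ y v]
    constructor <;> intro h <;> linear_combination h
  · simp
  · simp

variable {K : Type*} [Field K] [Algebra K F]

@[simp] lemma affine_mem_thetaUnital {θ x y : F} :
    Point.affine x y ∈ thetaUnital K θ ↔ y ∈ Submodule.span K {θ} := by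
  simp [thetaUnital, Submodule.mem_span_singleton, Algebra.smul_def, eq_comm]

@[simp] lemma slope_notMem_thetaUnital {θ a : F} : Point.slope a ∉ thetaUnital K θ := by
  simp [thetaUnital]

@[simp] lemma infty_mem_thetaUnital {θ : F} : Point.infty ∈ thetaUnital K θ := by
  simp [thetaUnital]

/-- If some collineation maps `U_κ` onto `U_θ`, then so does one that fixes `(∞)`. The stabiliser
of each unital is transitive on its affine points; transporting the one of `U_κ` to `U_θ` yields
a group that moves `(∞)` unless `φ` fixes it. -/
lemma exists_collineation_fixing_infty (hm : ∀ x y, f (x + y) = f x + f y + m x y) {κ : F →+ F}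
    (hκm : ∀ x y, κ (m x y) = m (κ x) (κ y)) (hκ : ∀ x, κ (κ x) = x) {θ : F}
    (φ : Collineation f)
    (hφ : ∀ P, φ.onPoints P ∈ thetaUnital K θ ↔ P ∈ polarityUnital f κ) :
    ∃ ψ : Collineation f, (∀ P, ψ.onPoints P ∈ thetaUnital K θ ↔ P ∈ polarityUnital f κ) ∧
      ψ.onPoints .infty = .infty := by
  by_cases h : φ.onPoints .infty = .infty
  · exact ⟨φ, hφ, h⟩
  obtain ⟨x₀, y₀, h₀⟩ : ∃ x y, φ.onPoints .infty = .affine x y := by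
    have h1 := (hφ .infty).2 infty_mem_polarityUnital
    rcases h2 : φ.onPoints .infty with ⟨x, y⟩ | b | _ <;> simp_all
  have hy₀ : y₀ ∈ Submodule.span K {θ} := by
    have h1 := (hφ .infty).2 infty_mem_polarityUnital
    rwa [h₀, affine_mem_thetaUnital] at h1
  have hback : ∀ Q ∈ thetaUnital K θ, Q ≠ .affine x₀ y₀ →
      ∃ x y, φ.onPoints (.affine x y) = Q ∧ y + κ y = f (x + κ x) := by
    intro Q hQ hne
    obtain ⟨P, rfl⟩ := φ.onPoints.surjective Q
    rcases P with ⟨x, y⟩ | b | _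
    · exact ⟨x, y, rfl, affine_mem_polarityUnital.1 ((hφ _).1 hQ)⟩
    · exact absurd ((hφ _).1 hQ) slope_notMem_polarityUnital
    · exact absurd h₀ hne
  obtain ⟨x₁, y₁, h₁, hU₁⟩ := hback (.affine (x₀ + 1) y₀) (by simpa using hy₀) (by simp)
  obtain ⟨x₂, y₂, h₂, hU₂⟩ := hback .infty (by simp) (by simp)
  -- `t` stabilises `U_θ` and moves `φ (∞)` to another affine point, which the conjugate under `φ`
  -- of the elation `g` taking `(x₁, y₁)` to `(x₂, y₂)` maps to `(∞)`
  let t := elation m hm 1 0 0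
  have ht : ∀ P, t.onPoints P ∈ thetaUnital K θ ↔ P ∈ thetaUnital K θ := by
    rintro (⟨x, y⟩ | a | _) <;> simp [t]
  let w := x₂ - x₁ + κ (x₂ - x₁)
  let v := y₂ - y₁ - m x₁ w
  have hv : v + κ v = f w := by
    have h1 : x₂ + κ x₂ = x₁ + κ x₁ + w := by simp only [w, map_sub]; ring
    have h2 : κ w = w := by simp only [w, map_add, hκ]; ring
    have h3 : κ (m x₁ w) = m (κ x₁) w := by rw [hκm, h2]
    rw [h1, hm, map_add m, AddMonoidHom.add_apply] at hU₂
    simp only [v, map_sub, h3]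
    linear_combination hU₂ - hU₁
  let g := elation m hm (x₂ - x₁) v w
  have hg : ∀ P, g.onPoints P ∈ polarityUnital f κ ↔ P ∈ polarityUnital f κ :=
    elation_mem_polarityUnital_iff hm hκm hκ hv
  have hg12 : g.onPoints (.affine x₁ y₁) = .affine x₂ y₂ := by
    simp only [g, v, elation_affine, Point.affine.injEq]
    exact ⟨by ring, by ring⟩
  refine ⟨(((φ.trans t).trans φ.symm).trans g).trans φ, fun P => ?_, ?_⟩
  · have h1 := hφ (φ.onPoints.symm (t.onPoints (φ.onPoints P)))
    rw [Equiv.apply_symm_apply] at h1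
    simp only [Collineation.trans, Collineation.symm, Equiv.trans_apply]
    rw [hφ, hg, ← h1, ht, hφ]
  · have h1 : φ.onPoints.symm (t.onPoints (.affine x₀ y₀)) = .affine x₁ y₁ := by
      rw [Equiv.symm_apply_eq, h₁]
      simp [t]
    simp only [Collineation.trans, Collineation.symm, Equiv.trans_apply]
    rw [h₀, h1, hg12, h₂]

/-- `L_∞` is the only line through `(∞)` that meets `U_κ`, respectively `U_θ`, in a single point. -/
lemma fixes_Linf_of_fixes_infty {κ : F → F} {θ : F} (φ : Collineation f)
    (hφ : ∀ P, φ.onPoints P ∈ thetaUnital K θ ↔ P ∈ polarityUnital f κ)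
    (h_infty : φ.onPoints .infty = .infty) : φ.onLines .Linf = .Linf := by
  have h1 := (φ.mem_iff .infty .Linf).2 (by simp)
  rw [h_infty] at h1
  rcases h : φ.onLines .Linf with ⟨a, b⟩ | a | _
  · simp [h] at h1
  · obtain ⟨P, hP⟩ := φ.onPoints.surjective (.affine a 0)
    have h2 := (hφ P).1 (by simp [hP])
    have h3 := (φ.mem_iff P .Linf).1 (by simp [hP, h])
    rcases P with ⟨x, y⟩ | b | _ <;> simp_all
  · rfl

end Unitals

/-! ### Comparison of the stabilisers -/

section Comparison

variable {F : Type*} [Field F] {f : F → F} {m : F →+ F →+ F}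

/-- An autotopism composed with an elation cannot map `U_κ` into `U_θ`. The hypotheses on `e` and
`o` say that the elations stabilising `U_κ` do not commute. -/
lemma not_mapsTo_thetaUnital [Finite F] {K : Type*} [Field K] [Algebra K F]
    (hm : ∀ x y, f (x + y) = f x + f y + m x y)
    (hreg : ∀ a ≠ 0, Function.Bijective fun x => m x a) {κ : F →+ F}
    (hκm : ∀ x y, κ (m x y) = m (κ x) (κ y)) (hκ : ∀ x, κ (κ x) = x)
    (hU : ∀ x, ∃ y, y + κ y = f (x + κ x))
    {e o : F} (he0 : e ≠ 0) (ho0 : o ≠ 0) (he : κ e = e) (ho : κ o = -o) (h2 : (2 : F) ≠ 0)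
    {θ : F} (hθ : Submodule.span K {θ} ≠ ⊤) {φ : Collineation f}
    (hφ : ∀ P ∈ polarityUnital f κ, φ.onPoints P ∈ thetaUnital K θ)
    (h_infty : φ.onPoints .infty = .infty) (h_Linf : φ.onLines .Linf = .Linf) : False := by
  obtain ⟨α, γ, β, u₀, v₀, w₀, hα, hβ, hβ0, hγ, h⟩ := exists_autotopism hm hreg φ h_infty h_Linf
  have hf0 := map_zero_of_polarization hm
  have hS : ∀ x y, y + κ y = f (x + κ x) →
      γ (y - f x) + f (α x) + v₀ + m (α x) w₀ ∈ Submodule.span K {θ} := by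
    intro x y hxy
    have h1 := hφ _ (affine_mem_polarityUnital.2 hxy)
    have h3 := h x (y - f x)
    rw [sub_add_cancel] at h3
    rwa [h3, affine_mem_thetaUnital] at h1
  -- compare the images of `(x, y)` and of its translate by an elation stabilising `U_κ`; at
  -- `x = y = 0` the difference of the two memberships only involves `u`
  have hmem : ∀ x u, m (α x) (β (κ u) + α u) ∈ Submodule.span K {θ} := by
    intro x u
    obtain ⟨v, hv⟩ := hU u
    obtain ⟨y, hy⟩ := hU x
    have h00 := hS 0 0 (by simp [hf0])
    have h0u := hS u v hv
    have h1 := hS x y hy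
    have h3 := hS (x + u) (y + v + m x (u + κ u)) <| affine_mem_polarityUnital.1 <|
      (elation_mem_polarityUnital_iff hm hκm hκ hv (.affine x y)).2
        (affine_mem_polarityUnital.2 hy)
    have h4 := Submodule.sub_mem _ (Submodule.sub_mem _ h3 h1) (Submodule.sub_mem _ h0u h00)
    convert h4 using 1
    rw [show y + v + m x (u + κ u) - f (x + u) = (y - f x) + (v - f u) + m x (κ u) by
      rw [hm, map_add]; ring, map_add γ, map_add γ, hγ, map_add α, hm (α x), map_add m,
      AddMonoidHom.add_apply, map_add (m (α x)), hf0, sub_self, map_zero, map_zero, hf0, map_zero,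
      AddMonoidHom.zero_apply]
    ring
  have hβκ : ∀ u, β (κ u) = -α u := by
    intro u
    by_contra hne
    refine hθ (eq_top_iff.2 fun z _ => ?_)
    obtain ⟨x', rfl⟩ := (hreg (β (κ u) + α u) fun h0 => hne (eq_neg_of_add_eq_zero_left h0)).2 z
    obtain ⟨x, rfl⟩ := (Finite.injective_iff_surjective.1 hα) x'
    exact hmem x u
  have hsymm : ∀ x u, γ (m x (κ u)) = γ (m u (κ x)) := by
    intro x u
    rw [hγ, hγ, hβκ, hβκ, map_neg, map_neg, polarization_comm hm]
  have h1 := hsymm e o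
  rw [he, ho, map_neg, map_neg, polarization_comm hm o e] at h1
  have h3 : γ (m e o) = 0 := by
    have : 2 * γ (m e o) = 0 := by linear_combination -h1
    exact (mul_eq_zero.1 this).resolve_left h2
  rw [hγ] at h3
  have hβo : β o ≠ 0 := fun h0 => ho0 (hβ (h0.trans hβ0.symm))
  have h4 : α e = 0 := (hreg _ hβo).1 (by simpa using h3)
  exact he0 (hα (h4.trans (map_zero α).symm))

end Comparison

end ShiftPlane
theorem theorem4p4
    -- `K` is the field with `q` elements, `q` odd, and `F` its extension with `q ^ 2` elements
    (q : ℕ) (hq : Odd q)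
    (K F : Type*) [Field K] [Field F] [Finite K] [Finite F] [Algebra K F]
    (hK : Nat.card K = q) (hF : Nat.card F = q ^ 2)
    -- a planar function `f` given by a Dembowski–Ostrom polynomial `P` over `F`
    (P : Polynomial F) (hP : ShiftPlane.IsDembowskiOstrom P)
    (f : F → F) (hfP : ∀ x : F, f x = P.eval x) (hf : ShiftPlane.IsPlanar f)
    -- the map `κ` that defines the unitary polarity
    (κ : F →+ F) (hκ_inv : ∀ x : F, κ (κ x) = x) (hκ_comm : ∀ x : F, κ (f x) = f (κ x))
    (hκ_card : ∀ x : F, Nat.card {y : F // y + κ y = f (x + κ x)} = q)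
    -- coordinates with respect to the basis `1, ξ` of `F` over `K`
    (ξ : F) (hξ : ξ ∉ Set.range (algebraMap K F))
    (f₀ f₁ : F → K) (hf01 : ∀ x : F, f x = algebraMap K F (f₀ x) + algebraMap K F (f₁ x) * ξ)
    (θ : F) (hθ : θ ≠ 0)
    (θ₀ θ₁ : K) (hθ01 : θ = algebraMap K F θ₀ + algebraMap K F θ₁ * ξ)
    -- the condition under which `U_θ` is defined
    (hθ_card_zero : Nat.card {x : F // θ₁ * f₀ x - θ₀ * f₁ x = 0} = 1)
    (hθ_card : ∀ c : K, c ≠ 0 → Nat.card {x : F // θ₁ * f₀ x - θ₀ * f₁ x = c} = q + 1) :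
    ¬ ShiftPlane.Equivalent f (ShiftPlane.polarityUnital f κ) (ShiftPlane.thetaUnital K θ) := by
  open ShiftPlane in
  rintro ⟨φ, hφ⟩
  obtain ⟨m, hm⟩ := hP.exists_polarization hfP
  have hreg : ∀ a ≠ 0, Function.Bijective fun x => m x a :=
    fun a ha => hf.polarization_bijective hm ha
  have hf0 := map_zero_of_polarization hm
  have hκm : ∀ x y, κ (m x y) = m (κ x) (κ y) := by
    intro x y
    have h1 := hm (κ x) (κ y)
    rw [← map_add, ← hκ_comm, ← hκ_comm, ← hκ_comm, hm, map_add, map_add] at h1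
    exact add_left_cancel h1
  have hq1 : 1 < q := hK ▸ Finite.one_lt_card
  have hq2 : q < q ^ 2 := by nlinarith
  have h2 : (2 : F) ≠ 0 := by
    have := Fintype.ofFinite F
    intro h0
    have hchar : ringChar F = 2 :=
      (Nat.prime_dvd_prime_iff_eq (CharP.char_is_prime F _) Nat.prime_two).1
        ((ringChar.spec F 2).1 (by exact_mod_cast h0))
    have heven := FiniteField.even_card_of_char_two hchar
    rw [← Nat.card_eq_fintype_card, hF] at heven
    exact (Nat.not_even_iff_odd.2 (hq.pow (n := 2))) (Nat.even_iff.2 heven)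
  -- `κ` is neither the identity nor `-1`, since exactly `q` elements satisfy `κ y = -y`
  have hcard0 : Nat.card {y : F // y + κ y = 0} = q := by
    have h := hκ_card 0
    rwa [map_zero, add_zero, hf0] at h
  obtain ⟨z, hz⟩ : ∃ z, z + κ z ≠ 0 := by
    by_contra! hall
    rw [Nat.card_congr (Equiv.subtypeUnivEquiv hall), hF] at hcard0
    omega
  obtain ⟨z', hz'⟩ : ∃ z, z - κ z ≠ 0 := by
    by_contra! hall
    have hsub : Subsingleton {y : F // y + κ y = 0} := by
      refine subsingleton_of_forall_eq ⟨0, by simp⟩ fun ⟨y, hy⟩ => Subtype.ext ?_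
      have h3 : 2 * y = 0 := by linear_combination hy + hall y
      exact (mul_eq_zero.1 h3).resolve_left h2
    have := Finite.card_le_one_iff_subsingleton.2 hsub
    omega
  have hU : ∀ x, ∃ y, y + κ y = f (x + κ x) := by
    intro x
    have h : 0 < Nat.card {y : F // y + κ y = f (x + κ x)} := by rw [hκ_card]; omega
    obtain ⟨y, hy⟩ := (Nat.card_pos_iff.1 h).1
    exact ⟨y, hy⟩
  have hspan : Submodule.span K {θ} ≠ ⊤ := by
    intro htop
    have hsurj : Function.Surjective fun t : K => t • θ := fun y =>
      Submodule.mem_span_singleton.1 (htop ▸ Submodule.mem_top)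
    have := Nat.card_le_card_of_surjective _ hsurj
    omega
  obtain ⟨ψ, hψ, hψ_infty⟩ := exists_collineation_fixing_infty (K := K) (θ := θ) hm hκm hκ_inv φ
    fun P => by rw [← hφ]; exact φ.onPoints.injective.mem_set_image
  exact not_mapsTo_thetaUnital hm hreg hκm hκ_inv hU hz hz' (by rw [map_add, hκ_inv]; ring)
    (by rw [map_sub, hκ_inv]; ring) h2 hspan (fun P hP => (hψ P).2 hP) hψ_infty
    (fixes_Linf_of_fixes_infty ψ hψ hψ_infty)
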